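/- Let $Y$ be a real random variable and $X$ a random vector in $\mathbb{R}^p$ with $E(Y^2)<\infty$, $E(\|X\|^2)<\infty$, $V(Y)>0$, $V(X)$ non-singular, and $E(Y|X)=\alpha_0+X'\beta_0$ for some $(\alpha_0,\beta_0)\in\mathbb{R}\times\mathbb{R}^p$. For an integrable random variable or vector $A$ write $A_0=A-E(A)$, and let $F_A$ denote the cdf of a real random variable $A$. For a cdf $F$ let $F^{-1}(t)=\inf\{x:F(x)\ge t\}$. For cdfs $F,G$ of mean-zero distributions and $\varepsilon\in(0,1/2)$ let $$R(\alpha,F,G)=\frac{\int_\alpha^1F^{-1}(t)\,dt}{\int_\alpha^1G^{-1}(t)\,dt},\qquad S_\varepsilon(F,G)=\min_{\alpha\in[\varepsilon,1-\varepsilon]}R(\alpha,F,G)$$ (with $R(\alpha,F,G)=+\infty$ if the denominator vanishes, which happens only if $G$ is degenerate), and, with $\mathbb{S}$ the Euclidean unit sphere of $\mathbb{R}^p$, $$\mathcal{B}_\varepsilon=\{\lambda q:\ q\in\mathbb{S},\ 0\le\lambda\le S_\varepsilon(F_{Y_0},F_{X_0'q})\}.$$ Let $(Y_1,\dots,Y_{n_Y})$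 and $(X_1,\dots,X_{n_X})$ be two independent samples of i.i.d. variables with the same distributions as $Y$ and $X$ respectively, with sample means $\overline{Y},\overline{X}$. Let $\widehat F_Y$ and $\widehat F_{X'q}$ be the empirical cdfs of $Y_1,\dots,Y_{n_Y}$ and $X_1'q,\dots,X_{n_X}'q$, let $\widehat F_{Y_0}(t)=\widehat F_Y(t+\overline{Y})$ and $\widehat F_{X_0'q}(t)=\widehat F_{X'q}(t+\overline{X}'q)$, and let $$\widehat{\mathcal{B}}_\varepsilon=\{\lambda q:\ q\in\mathbb{S},\ 0\le\lambda<\infty,\ \lambda\le S_\varepsilon(\widehat F_{Y_0},\widehat F_{X_0'q})\}.$$ Let $d_H(C,C')=\max\big(\sup_{c'\in C'}\inf_{c\in C}\|c-c'\|,\ \sup_{c\in C}\inf_{c'\in C'}\|c-c'\|\big)\in[0,\infty]$ be the Hausdorff distance. Then, for every $\varepsilon\in(0,1/2)$, as $n:=n_Xn_Y/(n_X+n_Y)\to\infty$, $$d_H(\widehat{\mathcal{B}}_\varepsilon,\mathcal{B}_\varepsilon)\ \stackrel{\mathbb{P}}{\longrightarrow}\ 0,$$ that is, $P\big(d_H(\widehat{\mathcal{B}}_\varepsilon,\mathcal{B}_\varepsilon)\ge\delta\big)\to0$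 for every $\delta>0$. -/

import Mathlib

open MeasureTheory ProbabilityTheory Filter Topology

noncomputable section

namespace TwoSample

/-- The generalized inverse `F⁻¹(t) = inf {x : F(x) ≥ t}` of a function `F : ℝ → ℝ`. -/
def quantile (F : ℝ → ℝ) (t : ℝ) : ℝ := sInf {x : ℝ | t ≤ F x}

/-- The upper quantile integral `∫_α^1 F⁻¹(t) dt`. -/
def upperInt (F : ℝ → ℝ) (α : ℝ) : ℝ := ∫ t in α..1, quantile F t

/-- The ratio of superquantiles `R(α, F, G) = ∫_α^1 F⁻¹ / ∫_α^1 G⁻¹`. For non-degenerate cdfs of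
mean zero both integrals are positive. The denominator vanishes when `G` is degenerate (which may
happen for an empirical cdf); the ratio is then `+∞`. -/
def superquantileRatio (α : ℝ) (F G : ℝ → ℝ) : EReal :=
  if upperInt G α = 0 then ⊤ else ((upperInt F α / upperInt G α : ℝ) : EReal)

/-- `S_ε(F, G) = min_{α ∈ [ε, 1 - ε]} R(α, F, G)`. -/
def radial (ε : ℝ) (F G : ℝ → ℝ) : EReal :=
  ⨅ α ∈ Set.Icc ε (1 - ε), superquantileRatio α F G

/-- The set `{λ q : q ∈ 𝕊, 0 ≤ λ ≤ S_ε(F, G_q)}`, where `𝕊` is the Euclidean unit sphere of `ℝ^p`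
and `G_q` is a cdf for each direction `q`. -/
def starSet {p : ℕ} (ε : ℝ) (F : ℝ → ℝ) (G : EuclideanSpace ℝ (Fin p) → ℝ → ℝ) :
    Set (EuclideanSpace ℝ (Fin p)) :=
  {b | ∃ q ∈ Metric.sphere (0 : EuclideanSpace ℝ (Fin p)) 1, ∃ l : ℝ,
    0 ≤ l ∧ (l : EReal) ≤ radial ε F (G q) ∧ b = l • q}

/-- The cdf of a real random variable `Z` under `P`. -/
def cdfOf {Ω : Type*} [MeasurableSpace Ω] (P : Measure Ω) (Z : Ω → ℝ) (t : ℝ) : ℝ :=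
  cdf (P.map Z) t

/-- The variance matrix `V(X)` of a random vector. -/
def varianceMatrix {Ω : Type*} [MeasurableSpace Ω] {p : ℕ} (P : Measure Ω)
    (X : Ω → EuclideanSpace ℝ (Fin p)) : Matrix (Fin p) (Fin p) ℝ :=
  Matrix.of fun i j => covariance (fun ω => X ω i) (fun ω => X ω j) P

/-- The regularized set `B_ε = {λ q : q ∈ 𝕊, 0 ≤ λ ≤ S_ε(F_{Y₀}, F_{X₀'q})}`, where
`Y₀ = Y - E(Y)` and `X₀ = X - E(X)`. -/
def regularizedSet {Ω : Type*} [MeasurableSpace Ω] {p : ℕ} (P : Measure Ω) (ε : ℝ)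
    (Y : Ω → ℝ) (X : Ω → EuclideanSpace ℝ (Fin p)) : Set (EuclideanSpace ℝ (Fin p)) :=
  starSet ε (cdfOf P fun ω => Y ω - ∫ ω', Y ω' ∂P)
    (fun q => cdfOf P fun ω => inner ℝ (X ω - ∫ ω', X ω' ∂P) q)

/-- The mean of the first `n` terms of a sequence. -/
def sampleMean {E : Type*} [AddCommGroup E] [Module ℝ E] (n : ℕ) (z : ℕ → E) : E :=
  (n : ℝ)⁻¹ • ∑ i ∈ Finset.range n, z i

/-- The empirical cdf of the first `n` terms of a real sequence. -/
def empiricalCdf (n : ℕ) (z : ℕ → ℝ) (t : ℝ) : ℝ :=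
  (((Finset.range n).filter fun i => z i ≤ t).card : ℝ) / n

/-- The plug-in estimator `{λ q : q ∈ 𝕊, 0 ≤ λ ≤ S_ε(F̂_{Y₀}, F̂_{X₀'q})}` computed from
`y 0, …, y (nY - 1)` and `x 0, …, x (nX - 1)`, where `F̂_{Y₀}(t) = F̂_Y(t + Ȳ)` and
`F̂_{X₀'q}(t) = F̂_{X'q}(t + X̄'q)`. -/
def pluginSet {p : ℕ} (ε : ℝ) (nY nX : ℕ) (y : ℕ → ℝ) (x : ℕ → EuclideanSpace ℝ (Fin p)) :
    Set (EuclideanSpace ℝ (Fin p)) :=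
  starSet ε (fun t => empiricalCdf nY y (t + sampleMean nY y))
    (fun q t => empiricalCdf nX (fun i => inner ℝ (x i) q) (t + inner ℝ (sampleMean nX x) q))

/-- The effective sample size `n = n_X n_Y / (n_X + n_Y)` for the pair `m = (n_Y, n_X)`. -/
def effectiveSize (m : ℕ × ℕ) : ℝ := ((m.2 : ℝ) * (m.1 : ℝ)) / ((m.2 : ℝ) + (m.1 : ℝ))

end TwoSample

end

/-!
By the Rockafellar–Uryasev formula, `∫_α^1 F⁻¹ = min_c {(1 - α) c + E (W - c)₊}`, the minimum being
attained at `c = F⁻¹(α)`. Superquantiles are therefore controlled, uniformly in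
`α ∈ [ε, 1 - ε]`, by the stop-loss transforms `E (X'q - c)₊` with `c` in a compact interval. As
`(q, c)` ranges over a compact set `K`, the functions `(q, c) ↦ (X'q - c)₊` form an integrable
random element of the separable Banach space `C(K, ℝ)`, whose strong law of large numbers makes
the empirical superquantiles converge uniformly in the direction `q` and in `α`. Since no `X'q` is
almost surely constant, compactness of the sphere bounds the superquantiles of `X₀'q` away from
zero, so that the ratios `R`, hence the radial functions `S_ε` of the two star-shaped sets, converge
uniformly as well.
-/

namespace TwoSample

open Set

section Quantile

variable (μ : Measure ℝ)

theorem quantile_cdf_le_iff {t x : ℝ} (ht : t ∈ Ioo 0 1) :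
    quantile (cdf μ) t ≤ x ↔ t ≤ cdf μ x := by
  have hne : {x | t ≤ cdf μ x}.Nonempty :=
    ((tendsto_cdf_atTop μ).eventually (eventually_ge_nhds ht.2)).exists
  obtain ⟨b, hb⟩ := ((tendsto_cdf_atBot μ).eventually (eventually_lt_nhds ht.1)).exists
  have hbdd : BddBelow {x | t ≤ cdf μ x} :=
    ⟨b, fun x hx => ((monotone_cdf μ).reflect_lt (hb.trans_le hx)).le⟩
  refine ⟨fun h => ?_, fun h => csInf_le hbdd h⟩
  have hright : Tendsto (cdf μ) (𝓝[>] x) (𝓝 (cdf μ x)) :=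
    ((cdf μ).right_continuous x).mono_left (nhdsWithin_mono x Ioi_subset_Ici_self)
  refine ge_of_tendsto hright ?_
  filter_upwards [self_mem_nhdsWithin] with y hy
  obtain ⟨z, hz, hzy⟩ := exists_lt_of_csInf_lt hne (h.trans_lt hy)
  exact le_trans hz (monotone_cdf μ hzy.le)

theorem monotoneOn_quantile_cdf : MonotoneOn (quantile (cdf μ)) (Ioo 0 1) := fun _ hs _ ht hst =>
  (quantile_cdf_le_iff μ hs).2 (hst.trans ((quantile_cdf_le_iff μ ht).1 le_rfl))

theorem aemeasurable_quantile_cdf :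
    AEMeasurable (quantile (cdf μ)) (volume.restrict (Ioo 0 1)) :=
  aemeasurable_restrict_of_monotoneOn measurableSet_Ioo (monotoneOn_quantile_cdf μ)

theorem map_quantile_cdf [IsProbabilityMeasure μ] :
    (volume.restrict (Ioo 0 1)).map (quantile (cdf μ)) = μ := by
  have : IsProbabilityMeasure (volume.restrict (Ioo (0 : ℝ) 1)) := ⟨by simp⟩
  have := Measure.isProbabilityMeasure_map (aemeasurable_quantile_cdf μ)
  refine Measure.ext_of_Iic _ _ fun x => ?_
  have hpre : quantile (cdf μ) ⁻¹' Iic x ∩ Ioo 0 1 = Iic (cdf μ x) ∩ Ioo 0 1 :=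
    ext fun t => and_congr_left fun ht => quantile_cdf_le_iff μ ht
  calc (volume.restrict (Ioo 0 1)).map (quantile (cdf μ)) (Iic x)
      = volume (Iic (cdf μ x) ∩ Ioo 0 1) := by
        rw [Measure.map_apply_of_aemeasurable (aemeasurable_quantile_cdf μ) measurableSet_Iic,
          Measure.restrict_apply₀' nullMeasurableSet_Ioo, hpre]
    _ = volume (Iic (cdf μ x) ∩ Ioc 0 1) := measure_congr (ae_eq_rfl.inter Ioo_ae_eq_Ioc)
    _ = μ (Iic x) := by
        rw [inter_comm, Ioc_inter_Iic, min_eq_right (cdf_le_one μ x), Real.volume_Ioc, sub_zero,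
          ofReal_cdf]

end Quantile

theorem integral_eq_integral_max_sub_integral_max_neg {Ω : Type*} [MeasurableSpace Ω]
    {P : Measure Ω} {W : Ω → ℝ} (hW : Integrable W P) :
    ∫ ω, W ω ∂P = ∫ ω, max (W ω) 0 ∂P - ∫ ω, max (-W ω) 0 ∂P := by
  simpa only [Real.coe_toNNReal'] using integral_eq_integral_pos_part_sub_integral_neg_part hW

theorem integral_abs_eq_integral_max_add_integral_max_neg {Ω : Type*} [MeasurableSpace Ω]
    {P : Measure Ω} {W : Ω → ℝ} (hW : Integrable W P) :
    ∫ ω, |W ω| ∂P = ∫ ω, max (W ω) 0 ∂P + ∫ ω, max (-W ω) 0 ∂P := by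
  simp only [← integral_add hW.pos_part hW.neg_part, max_zero_add_max_neg_zero_eq_abs_self]

section Superquantile

variable {Ω : Type*} [MeasurableSpace Ω] {P : Measure Ω} [IsProbabilityMeasure P]
  {Ω' : Type*} [MeasurableSpace Ω'] {P' : Measure Ω'} [IsProbabilityMeasure P']
  {W : Ω → ℝ} {W' : Ω' → ℝ} {α ε : ℝ}

theorem identDistrib_quantile_cdfOf (hW : AEMeasurable W P) :
    IdentDistrib (quantile (cdfOf P W)) W (volume.restrict (Ioo 0 1)) P where
  aemeasurable_fst := aemeasurable_quantile_cdf (P.map W)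
  aemeasurable_snd := hW
  map_eq :=
    have := Measure.isProbabilityMeasure_map hW
    map_quantile_cdf (P.map W)

theorem upperInt_eq_setIntegral_Ioo (F : ℝ → ℝ) (hα : α ≤ 1) :
    upperInt F α = ∫ t in Ioo α 1, quantile F t := by
  rw [upperInt, intervalIntegral.integral_of_le hα, integral_Ioc_eq_integral_Ioo]

theorem integrable_max_sub (hW : Integrable W P) (c : ℝ) :
    Integrable (fun ω => max (W ω - c) 0) P :=
  (hW.sub (integrable_const c)).pos_part

theorem integral_max_sub_eq_setIntegral_quantile (hW : AEMeasurable W P) (c : ℝ) :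
    ∫ ω, max (W ω - c) 0 ∂P = ∫ t in Ioo 0 1, max (quantile (cdfOf P W) t - c) 0 :=
  ((identDistrib_quantile_cdfOf hW).comp
    (u := fun x => max (x - c) 0) (by fun_prop)).integral_eq.symm

theorem integrableOn_quantile_cdfOf (hW : Integrable W P) :
    IntegrableOn (quantile (cdfOf P W)) (Ioo 0 1) :=
  (identDistrib_quantile_cdfOf hW.aemeasurable).integrable_iff.2 hW

theorem integrableOn_max_quantile_sub (hW : Integrable W P) (c : ℝ) :
    IntegrableOn (fun t => max (quantile (cdfOf P W) t - c) 0) (Ioo 0 1) :=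
  ((identDistrib_quantile_cdfOf hW.aemeasurable).comp
    (u := fun x => max (x - c) 0) (by fun_prop)).integrable_iff.2 (integrable_max_sub hW c)

theorem upperInt_cdfOf_le (hW : Integrable W P) (hα : α ∈ Ioo 0 1) (c : ℝ) :
    upperInt (cdfOf P W) α ≤ (1 - α) * c + ∫ ω, max (W ω - c) 0 ∂P := by
  have hsub : Ioo α 1 ⊆ Ioo 0 1 := Ioo_subset_Ioo_left hα.1.le
  have hmax := integrableOn_max_quantile_sub hW c
  have hconst : IntegrableOn (fun _ => c) (Ioo α 1) := integrableOn_const (by simp)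
  rw [upperInt_eq_setIntegral_Ioo _ hα.2.le,
    integral_max_sub_eq_setIntegral_quantile hW.aemeasurable]
  calc ∫ t in Ioo α 1, quantile (cdfOf P W) t
      ≤ ∫ t in Ioo α 1, (c + max (quantile (cdfOf P W) t - c) 0) :=
        setIntegral_mono ((integrableOn_quantile_cdfOf hW).mono_set hsub)
          (hconst.add (hmax.mono_set hsub)) fun t => sub_le_iff_le_add'.1 (le_max_left _ _)
    _ = (1 - α) * c + ∫ t in Ioo α 1, max (quantile (cdfOf P W) t - c) 0 := by
        rw [integral_add hconst (hmax.mono_set hsub)]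
        simp [hα.2.le]
    _ ≤ (1 - α) * c + ∫ t in Ioo 0 1, max (quantile (cdfOf P W) t - c) 0 :=
        add_le_add le_rfl <|
          setIntegral_mono_set hmax (.of_forall fun t => le_max_right _ _) hsub.eventuallyLE

theorem upperInt_cdfOf_eq (hW : Integrable W P) (hα : α ∈ Ioo 0 1) :
    upperInt (cdfOf P W) α = (1 - α) * quantile (cdfOf P W) α +
      ∫ ω, max (W ω - quantile (cdfOf P W) α) 0 ∂P := by
  set Q := quantile (cdfOf P W)
  have hsub : Ioo α 1 ⊆ Ioo 0 1 := Ioo_subset_Ioo_left hα.1.le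
  have hmono : MonotoneOn Q (Ioo 0 1) := monotoneOn_quantile_cdf (P.map W)
  have hbelow : ∀ t ∈ Ioo 0 1 \ Ioo α 1, max (Q t - Q α) 0 = 0 := fun t ht =>
    max_eq_right (sub_nonpos.2 (hmono ht.1 hα (not_lt.1 fun h => ht.2 ⟨h, ht.1.2⟩)))
  have habove : EqOn (fun t => max (Q t - Q α) 0) (fun t => Q t - Q α) (Ioo α 1) := fun t ht =>
    max_eq_left (sub_nonneg.2 (hmono hα (hsub ht) ht.1.le))
  have htail : ∫ ω, max (W ω - Q α) 0 ∂P = (∫ t in Ioo α 1, Q t) - (1 - α) * Q α := by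
    rw [integral_max_sub_eq_setIntegral_quantile hW.aemeasurable,
      setIntegral_eq_of_subset_of_forall_sdiff_eq_zero measurableSet_Ioo hsub hbelow,
      setIntegral_congr_fun measurableSet_Ioo habove,
      integral_sub ((integrableOn_quantile_cdfOf hW).mono_set hsub) (integrableOn_const (by simp))]
    simp [Q, hα.2.le]
  rw [htail, add_sub_cancel]
  exact upperInt_eq_setIntegral_Ioo _ hα.2.le

theorem upperInt_cdfOf_sub_const_le (hW : Integrable W P) (hα : α ∈ Ioo 0 1) (a : ℝ) :
    upperInt (cdfOf P fun ω => W ω - a) α ≤ upperInt (cdfOf P W) α - (1 - α) * a := by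
  have h := upperInt_cdfOf_le (W := fun ω => W ω - a) (hW.sub (integrable_const a)) hα
    (quantile (cdfOf P W) α - a)
  rw [upperInt_cdfOf_eq hW hα]
  simp only [sub_sub_sub_cancel_right] at h
  linarith

theorem upperInt_cdfOf_sub_const (hW : Integrable W P) (hα : α ∈ Ioo 0 1) (a : ℝ) :
    upperInt (cdfOf P fun ω => W ω - a) α = upperInt (cdfOf P W) α - (1 - α) * a := by
  refine le_antisymm (upperInt_cdfOf_sub_const_le hW hα a) ?_
  have h := upperInt_cdfOf_sub_const_le (W := fun ω => W ω - a)
    (hW.sub (integrable_const a)) hα (-a)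
  simp only [sub_neg_eq_add, sub_add_cancel] at h
  linarith

theorem mul_abs_quantile_cdfOf_le (hW : Integrable W P) (hε : 0 < ε) (hα : α ∈ Icc ε (1 - ε)) :
    ε * |quantile (cdfOf P W) α| ≤ ∫ ω, |W ω| ∂P := by
  have hα' : α ∈ Ioo 0 1 := Icc_subset_Ioo hε (sub_lt_self 1 hε) hα
  set c := quantile (cdfOf P W) α
  have hvar : (1 - α) * c + ∫ ω, max (W ω - c) 0 ∂P ≤ ∫ ω, max (W ω) 0 ∂P := by
    simpa [upperInt_cdfOf_eq hW hα'] using upperInt_cdfOf_le hW hα' 0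
  have hpos : ∫ ω, max (W ω) 0 ∂P ≤ ∫ ω, |W ω| ∂P :=
    integral_mono hW.pos_part hW.abs fun ω => max_le (le_abs_self _) (abs_nonneg _)
  rcases le_total 0 c with hc | hc
  · have htail : 0 ≤ ∫ ω, max (W ω - c) 0 ∂P := integral_nonneg fun _ => le_max_right _ _
    rw [abs_of_nonneg hc]
    nlinarith [hα.2]
  · have htail : (∫ ω, W ω ∂P) - c ≤ ∫ ω, max (W ω - c) 0 ∂P := by
      calc (∫ ω, W ω ∂P) - c = ∫ ω, (W ω - c) ∂P := by
            rw [integral_sub hW (integrable_const c)]; simp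
        _ ≤ _ := integral_mono (hW.sub (integrable_const c)) (integrable_max_sub hW c)
            fun _ => le_max_left _ _
    have hneg : (∫ ω, max (W ω) 0 ∂P) - ∫ ω, W ω ∂P ≤ ∫ ω, |W ω| ∂P := by
      rw [← integral_sub hW.pos_part hW]
      exact integral_mono (hW.pos_part.sub hW) hW.abs fun ω => by
        rw [← max_sub_sub_right, sub_self, zero_sub]
        exact max_le (abs_nonneg _) (neg_le_abs _)
    rw [abs_of_nonpos hc]
    nlinarith [hα.1]

theorem upperInt_cdfOf_le_add {M η : ℝ} (hW : Integrable W P) (hW' : Integrable W' P')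
    (hε : 0 < ε) (hα : α ∈ Icc ε (1 - ε)) (hM : ∫ ω, |W' ω| ∂P' ≤ ε * M)
    (h : ∀ c, |c| ≤ M → ∫ ω, max (W ω - c) 0 ∂P ≤ ∫ ω, max (W' ω - c) 0 ∂P' + η) :
    upperInt (cdfOf P W) α ≤ upperInt (cdfOf P' W') α + η := by
  have hα' : α ∈ Ioo 0 1 := Icc_subset_Ioo hε (sub_lt_self 1 hε) hα
  have hc : |quantile (cdfOf P' W') α| ≤ M :=
    le_of_mul_le_mul_left ((mul_abs_quantile_cdfOf_le hW' hε hα).trans hM) hε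
  rw [upperInt_cdfOf_eq hW' hα']
  linarith [upperInt_cdfOf_le hW hα' (quantile (cdfOf P' W') α), h _ hc]

theorem exists_forall_mul_abs_add_mul_le (hε : 0 < ε) (hα : α ∈ Icc ε (1 - ε)) (c : ℝ) :
    ∃ s : ℝ, ∀ w : ℝ, ε * |w| + s * w ≤ 2 * ((1 - α) * c + max (w - c) 0) := by
  obtain ⟨hεα, hα⟩ := hα
  rcases le_total 0 c with hc | hc
  · refine ⟨1 - α, fun w => ?_⟩
    rcases abs_cases w with ⟨habs, _⟩ | ⟨habs, _⟩ <;>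
      rcases max_cases (w - c) 0 with ⟨hmax, _⟩ | ⟨hmax, _⟩ <;> rw [habs, hmax] <;> nlinarith
  · refine ⟨2 - α, fun w => ?_⟩
    rcases abs_cases w with ⟨habs, _⟩ | ⟨habs, _⟩ <;>
      rcases max_cases (w - c) 0 with ⟨hmax, _⟩ | ⟨hmax, _⟩ <;> rw [habs, hmax] <;> nlinarith

theorem mul_integral_abs_le_two_mul_upperInt_cdfOf (hW : Integrable W P) (h0 : ∫ ω, W ω ∂P = 0)
    (hε : 0 < ε) (hα : α ∈ Icc ε (1 - ε)) :
    ε * ∫ ω, |W ω| ∂P ≤ 2 * upperInt (cdfOf P W) α := by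
  have hα' : α ∈ Ioo 0 1 := Icc_subset_Ioo hε (sub_lt_self 1 hε) hα
  obtain ⟨s, hs⟩ := exists_forall_mul_abs_add_mul_le hε hα (quantile (cdfOf P W) α)
  have hmax := integrable_max_sub hW (quantile (cdfOf P W) α)
  calc ε * ∫ ω, |W ω| ∂P = ∫ ω, (ε * |W ω| + s * W ω) ∂P := by
        rw [integral_add (hW.abs.const_mul ε) (hW.const_mul s), integral_const_mul,
          integral_const_mul, h0, mul_zero, add_zero]
    _ ≤ ∫ ω, 2 * ((1 - α) * quantile (cdfOf P W) α + max (W ω - quantile (cdfOf P W) α) 0) ∂P :=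
        integral_mono ((hW.abs.const_mul ε).add (hW.const_mul s))
          (((integrable_const _).add hmax).const_mul 2) fun ω => hs (W ω)
    _ = 2 * upperInt (cdfOf P W) α := by
        rw [upperInt_cdfOf_eq hW hα', integral_const_mul, integral_add (integrable_const _) hmax,
          integral_const, probReal_univ, one_smul]

/-- The cdf `F_{W₀}` of the centred variable `W₀ = W - E(W)`. -/
noncomputable def centeredCdf (P : Measure Ω) (W : Ω → ℝ) : ℝ → ℝ :=
  cdfOf P fun ω => W ω - ∫ ω', W ω' ∂P

theorem upperInt_centeredCdf (hW : Integrable W P) (hα : α ∈ Ioo 0 1) :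
    upperInt (centeredCdf P W) α = upperInt (cdfOf P W) α - (1 - α) * ∫ ω, W ω ∂P :=
  upperInt_cdfOf_sub_const hW hα _

theorem upperInt_centeredCdf_le (hW : Integrable W P) (hα : α ∈ Ioo 0 1) :
    upperInt (centeredCdf P W) α ≤ ∫ ω, |W ω - ∫ ω', W ω' ∂P| ∂P := by
  have hW₀ : Integrable (fun ω => W ω - ∫ ω', W ω' ∂P) P := hW.sub (integrable_const _)
  calc upperInt (centeredCdf P W) α
      ≤ (1 - α) * 0 + ∫ ω, max (W ω - (∫ ω', W ω' ∂P) - 0) 0 ∂P := upperInt_cdfOf_le hW₀ hα 0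
    _ ≤ ∫ ω, |W ω - ∫ ω', W ω' ∂P| ∂P := by
        simp only [mul_zero, zero_add, sub_zero]
        exact integral_mono hW₀.pos_part hW₀.abs fun ω => max_le (le_abs_self _) (abs_nonneg _)

theorem mul_integral_abs_le_two_mul_upperInt_centeredCdf (hW : Integrable W P) (hε : 0 < ε)
    (hα : α ∈ Icc ε (1 - ε)) :
    ε * ∫ ω, |W ω - ∫ ω', W ω' ∂P| ∂P ≤ 2 * upperInt (centeredCdf P W) α :=
  mul_integral_abs_le_two_mul_upperInt_cdfOf (hW.sub (integrable_const _))
    (by rw [integral_sub hW (integrable_const _)]; simp) hε hα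

theorem upperInt_centeredCdf_nonneg (hW : Integrable W P) (hε : 0 < ε)
    (hα : α ∈ Icc ε (1 - ε)) : 0 ≤ upperInt (centeredCdf P W) α := by
  have habs : 0 ≤ ε * ∫ ω, |W ω - ∫ ω', W ω' ∂P| ∂P :=
    mul_nonneg hε.le (integral_nonneg fun _ => abs_nonneg _)
  linarith [mul_integral_abs_le_two_mul_upperInt_centeredCdf hW hε hα]

theorem abs_upperInt_centeredCdf_sub_le {M η : ℝ} (hW : Integrable W P) (hW' : Integrable W' P')
    (hε : 0 < ε) (hα : α ∈ Icc ε (1 - ε)) (hM : ∫ ω, |W ω| ∂P + 2 * η ≤ ε * M)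
    (hneg : |∫ ω, max (-W' ω) 0 ∂P' - ∫ ω, max (-W ω) 0 ∂P| ≤ η)
    (h : ∀ c, |c| ≤ M → |∫ ω, max (W' ω - c) 0 ∂P' - ∫ ω, max (W ω - c) 0 ∂P| ≤ η) :
    |upperInt (centeredCdf P' W') α - upperInt (centeredCdf P W) α| ≤ 3 * η := by
  have hα' : α ∈ Ioo 0 1 := Icc_subset_Ioo hε (sub_lt_self 1 hε) hα
  have hη : 0 ≤ η := (abs_nonneg _).trans hneg
  have hM0 : 0 ≤ M := nonneg_of_mul_nonneg_right
    ((add_nonneg (integral_nonneg fun _ => abs_nonneg _) (by positivity)).trans hM) hε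
  have hpos : |∫ ω, max (W' ω) 0 ∂P' - ∫ ω, max (W ω) 0 ∂P| ≤ η := by
    simpa only [sub_zero] using h 0 (by rwa [abs_zero])
  rw [abs_le] at hpos hneg
  have hmean : |∫ ω, W' ω ∂P' - ∫ ω, W ω ∂P| ≤ 2 * η := by
    rw [integral_eq_integral_max_sub_integral_max_neg hW,
      integral_eq_integral_max_sub_integral_max_neg hW', abs_le]
    constructor <;> linarith
  have habs : ∫ ω, |W' ω| ∂P' ≤ ε * M := by
    rw [integral_abs_eq_integral_max_add_integral_max_neg hW] at hM
    rw [integral_abs_eq_integral_max_add_integral_max_neg hW']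
    linarith
  have hupper : |upperInt (cdfOf P' W') α - upperInt (cdfOf P W) α| ≤ η := by
    have hle := upperInt_cdfOf_le_add hW' hW hε hα (by linarith) fun c hc =>
      sub_le_iff_le_add'.1 (abs_le.1 (h c hc)).2
    have hge := upperInt_cdfOf_le_add hW hW' hε hα habs fun c hc =>
      neg_le_sub_iff_le_add.1 (abs_le.1 (h c hc)).1
    rw [abs_le]
    constructor <;> linarith
  have hshift : |(1 - α) * (∫ ω, W' ω ∂P' - ∫ ω, W ω ∂P)| ≤ 2 * η := by
    rw [abs_mul, abs_of_pos (sub_pos.2 hα'.2)]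
    exact (mul_le_of_le_one_left (abs_nonneg _) (by linarith [hα'.1])).trans hmean
  rw [upperInt_centeredCdf hW hα', upperInt_centeredCdf hW' hα']
  rw [abs_le] at hupper hshift ⊢
  constructor <;> linarith

end Superquantile

section Empirical

/-- The uniform distribution on the first `n` indices; under it a sequence is distributed as its
empirical distribution. -/
noncomputable def sampleMeasure (n : ℕ) : Measure ℕ := uniformOn (Finset.range n : Set ℕ)

variable {n : ℕ}

theorem integrableOn_count_finset {X B : Type*} [MeasurableSpace X] [MeasurableSingletonClass X]
    [NormedAddCommGroup B] (s : Finset X) (f : X → B) : IntegrableOn f s Measure.count := by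
  have : IsFiniteMeasure (Measure.count.restrict (s : Set X)) := ⟨by simp⟩
  simpa [IntegrableOn, Measure.restrict_restrict s.measurableSet] using
    IntegrableOn.finset (μ := Measure.count.restrict (s : Set X)) (s := s) (f := f)

theorem isProbabilityMeasure_sampleMeasure (hn : n ≠ 0) :
    IsProbabilityMeasure (sampleMeasure n) :=
  isProbabilityMeasure_uniformOn (Finset.finite_toSet _)
    (Finset.coe_nonempty.2 (Finset.nonempty_range_iff.2 hn))

theorem integrable_sampleMeasure {B : Type*} [NormedAddCommGroup B] (hn : n ≠ 0) (f : ℕ → B) :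
    Integrable f (sampleMeasure n) := by
  refine (integrableOn_count_finset _ f).smul_measure (ENNReal.inv_ne_top.2 ?_)
  simpa using hn

theorem integral_sampleMeasure {B : Type*} [NormedAddCommGroup B] [NormedSpace ℝ B]
    [CompleteSpace B] (f : ℕ → B) : ∫ i, f i ∂sampleMeasure n = sampleMean n f := by
  rw [sampleMeasure, uniformOn, ProbabilityTheory.cond, integral_smul_measure,
    setIntegral_finset _ (integrableOn_count_finset _ f), Measure.count_apply_finset]
  simp [sampleMean]

theorem cdfOf_sampleMeasure (hn : n ≠ 0) (z : ℕ → ℝ) :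
    cdfOf (sampleMeasure n) z = empiricalCdf n z := by
  have hz : Measurable z := Measurable.of_discrete
  have := isProbabilityMeasure_sampleMeasure hn
  have := Measure.isProbabilityMeasure_map (μ := sampleMeasure n) hz.aemeasurable
  ext t
  have hfilter : (Finset.range n : Set ℕ) ∩ z ⁻¹' Iic t =
      ((Finset.range n).filter fun i => z i ≤ t : Finset ℕ) := by
    rw [Finset.coe_filter]; rfl
  rw [cdfOf, cdf_eq_real, map_measureReal_apply hz measurableSet_Iic, measureReal_def,
    sampleMeasure, ← uniformOn_inter_self (Finset.finite_toSet _), hfilter, uniformOn_apply_finset,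
    Finset.inter_eq_right.2 (Finset.filter_subset _ _)]
  simp [empiricalCdf]

theorem empiricalCdf_add (z : ℕ → ℝ) (t m : ℝ) :
    empiricalCdf n z (t + m) = empiricalCdf n (fun i => z i - m) t := by
  simp only [empiricalCdf, sub_le_iff_le_add]

theorem empiricalCdf_add_sampleMean (hn : n ≠ 0) (z : ℕ → ℝ) :
    (fun t => empiricalCdf n z (t + sampleMean n z)) = centeredCdf (sampleMeasure n) z := by
  ext t
  rw [empiricalCdf_add, centeredCdf, integral_sampleMeasure, cdfOf_sampleMeasure hn]

theorem sampleMean_inner {E : Type*} [NormedAddCommGroup E] [InnerProductSpace ℝ E]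
    (x : ℕ → E) (q : E) :
    sampleMean n (fun i => inner ℝ (x i) q) = inner ℝ (sampleMean n x) q := by
  simp only [sampleMean, real_inner_smul_left, sum_inner, smul_eq_mul]

variable {p : ℕ}

theorem pluginSet_eq_starSet {nY nX : ℕ} (hY : nY ≠ 0) (hX : nX ≠ 0) (ε : ℝ) (y : ℕ → ℝ)
    (x : ℕ → EuclideanSpace ℝ (Fin p)) :
    pluginSet ε nY nX y x = starSet ε (centeredCdf (sampleMeasure nY) y)
      fun q => centeredCdf (sampleMeasure nX) fun i => inner ℝ (x i) q := by
  rw [pluginSet, empiricalCdf_add_sampleMean hY]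
  congr 1
  ext q : 1
  rw [← sampleMean_inner, empiricalCdf_add_sampleMean hX]

theorem integral_inner_const {Ω E : Type*} [MeasurableSpace Ω] {P : Measure Ω}
    [NormedAddCommGroup E] [InnerProductSpace ℝ E] [CompleteSpace E] {X : Ω → E}
    (hX : Integrable X P) (q : E) : ∫ ω, inner ℝ (X ω) q ∂P = inner ℝ (∫ ω, X ω ∂P) q := by
  simpa only [real_inner_comm q] using integral_inner (𝕜 := ℝ) hX q

theorem regularizedSet_eq_starSet {Ω : Type*} [MeasurableSpace Ω] {P : Measure Ω} (ε : ℝ)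
    (Y : Ω → ℝ) {X : Ω → EuclideanSpace ℝ (Fin p)} (hX : Integrable X P) :
    regularizedSet P ε Y X =
      starSet ε (centeredCdf P Y) fun q => centeredCdf P fun ω => inner ℝ (X ω) q := by
  simp only [regularizedSet, centeredCdf, inner_sub_left, integral_inner_const hX]

end Empirical

section LawOfLargeNumbers

variable {Ω₀ : Type*} [MeasurableSpace Ω₀] {P₀ : Measure Ω₀}
  {Ω : Type*} [MeasurableSpace Ω] {P : Measure Ω} [IsFiniteMeasure P]

theorem tendstoInMeasure_sampleMean {B : Type*} [NormedAddCommGroup B] [NormedSpace ℝ B]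
    [CompleteSpace B] [MeasurableSpace B] [BorelSpace B] {Z : Ω₀ → B} {Zs : ℕ → Ω → B}
    (hZ : Integrable Z P₀) (hid : ∀ i, IdentDistrib (Zs i) Z P P₀)
    (hind : Pairwise fun i j => IndepFun (Zs i) (Zs j) P) :
    TendstoInMeasure P (fun n ω => sampleMean n fun i => Zs i ω) atTop
      fun _ => ∫ ω, Z ω ∂P₀ := by
  have hint : ∀ i, Integrable (Zs i) P := fun i => (hid i).integrable_iff.2 hZ
  have hmeas : ∀ n, AEStronglyMeasurable (fun ω => sampleMean n fun i => Zs i ω) P := fun n =>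
    (Finset.aestronglyMeasurable_fun_sum _ fun i _ => (hint i).aestronglyMeasurable).const_smul _
  rw [← (hid 0).integral_eq]
  exact tendstoInMeasure_of_tendsto_ae hmeas
    (strong_law_ae Zs (hint 0) hind fun i => (hid i).trans (hid 0).symm)

end LawOfLargeNumbers

section StopLoss

variable {E : Type*} [NormedAddCommGroup E] [InnerProductSpace ℝ E]

/-- The stop-loss functions `(q, c) ↦ (x'q - c)₊` of a data point `x`, as a continuous function on
a set of directions `q` and retentions `c`. -/
noncomputable def stopLoss (K : Set (E × ℝ)) (x : E) : C(K, ℝ) :=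
  ⟨fun k => max (inner ℝ x k.1.1 - k.1.2) 0, by fun_prop⟩

theorem continuous_stopLoss (K : Set (E × ℝ)) : Continuous (stopLoss K) :=
  (ContinuousMap.curry ⟨fun z : E × K => max (inner ℝ z.1 z.2.1.1 - z.2.1.2) 0,
    by fun_prop⟩).continuous

theorem norm_stopLoss_le {K : Set (E × ℝ)} [CompactSpace K] {R : ℝ} (hR : 0 ≤ R)
    (hK : ∀ k ∈ K, ‖k‖ ≤ R) (x : E) : ‖stopLoss K x‖ ≤ R * ‖x‖ + R := by
  rw [ContinuousMap.norm_le _ (by positivity)]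
  rintro ⟨⟨q, c⟩, hk⟩
  have hq : ‖q‖ ≤ R := (norm_fst_le (q, c)).trans (hK _ hk)
  have hc : |c| ≤ R := (norm_snd_le (q, c)).trans (hK _ hk)
  have hinner : inner ℝ x q ≤ R * ‖x‖ :=
    (real_inner_le_norm x q).trans (by rw [mul_comm]; gcongr)
  refine (Real.norm_of_nonneg (le_max_right (inner ℝ x q - c) 0)).trans_le ?_
  exact max_le (by linarith [neg_abs_le c]) (by positivity)

variable {Ω : Type*} [MeasurableSpace Ω] {P : Measure Ω} [IsProbabilityMeasure P] {X : Ω → E}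
  {Ω' : Type*} [MeasurableSpace Ω'] {P' : Measure Ω'} [IsProbabilityMeasure P'] {X' : Ω' → E}

theorem integrable_stopLoss {K : Set (E × ℝ)} [CompactSpace K] (hX : Integrable X P) :
    Integrable (fun ω => stopLoss K (X ω)) P := by
  have hcompact : IsCompact K := isCompact_iff_compactSpace.2 ‹_›
  obtain ⟨R, hR, hK⟩ := hcompact.isBounded.exists_pos_norm_le
  exact ((hX.norm.const_mul R).add (integrable_const R)).mono'
    ((continuous_stopLoss K).comp_aestronglyMeasurable hX.aestronglyMeasurable)
    (.of_forall fun ω => norm_stopLoss_le hR.le hK (X ω))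

theorem abs_integral_max_sub_le {K : Set (E × ℝ)} [CompactSpace K] (hX : Integrable X P)
    (hX' : Integrable X' P') {q : E} {c : ℝ} (hk : (q, c) ∈ K) :
    |∫ ω, max (inner ℝ (X' ω) q - c) 0 ∂P' - ∫ ω, max (inner ℝ (X ω) q - c) 0 ∂P| ≤
      ‖∫ ω, stopLoss K (X' ω) ∂P' - ∫ ω, stopLoss K (X ω) ∂P‖ := by
  have h := (∫ ω, stopLoss K (X' ω) ∂P' - ∫ ω, stopLoss K (X ω) ∂P).norm_coe_le_norm ⟨(q, c), hk⟩
  rwa [ContinuousMap.sub_apply, ContinuousMap.integral_apply (integrable_stopLoss hX),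
    ContinuousMap.integral_apply (integrable_stopLoss hX')] at h

theorem abs_upperInt_centeredCdf_inner_sub_le {K : Set (E × ℝ)} [CompactSpace K] {M η ε α : ℝ}
    (hX : Integrable X P) (hX' : Integrable X' P') (hε : 0 < ε) (hα : α ∈ Icc ε (1 - ε))
    (hM : ∫ ω, ‖X ω‖ ∂P + 2 * η ≤ ε * M)
    (h : ‖∫ ω, stopLoss K (X' ω) ∂P' - ∫ ω, stopLoss K (X ω) ∂P‖ ≤ η)
    {q : E} (hq : ‖q‖ ≤ 1) (hneg : (-q, 0) ∈ K) (hK : ∀ c, |c| ≤ M → (q, c) ∈ K) :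
    |upperInt (centeredCdf P' fun ω => inner ℝ (X' ω) q) α -
      upperInt (centeredCdf P fun ω => inner ℝ (X ω) q) α| ≤ 3 * η := by
  have habs : ∫ ω, |inner ℝ (X ω) q| ∂P ≤ ∫ ω, ‖X ω‖ ∂P :=
    integral_mono (hX.inner_const q).abs hX.norm fun ω =>
      (abs_real_inner_le_norm _ _).trans (mul_le_of_le_one_right (norm_nonneg _) hq)
  refine abs_upperInt_centeredCdf_sub_le (hX.inner_const q) (hX'.inner_const q) hε hα
    (by linarith) ?_ fun c hc => (abs_integral_max_sub_le hX hX' (hK c hc)).trans h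
  simpa only [inner_neg_right, sub_zero] using (abs_integral_max_sub_le hX hX' hneg).trans h

variable [MeasurableSpace E] [BorelSpace E] {Xs : ℕ → Ω' → E}

theorem tendstoInMeasure_sampleMean_stopLoss {K : Set (E × ℝ)} [CompactSpace K]
    (hX : Integrable X P) (hid : ∀ i, IdentDistrib (Xs i) X P' P)
    (hind : Pairwise fun i j => IndepFun (Xs i) (Xs j) P') :
    TendstoInMeasure P' (fun n ω => sampleMean n fun i => stopLoss K (Xs i ω)) atTop
      fun _ => ∫ ω, stopLoss K (X ω) ∂P := by
  borelize C(K, ℝ)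
  have hmeas : Measurable (stopLoss K) := (continuous_stopLoss K).measurable
  exact tendstoInMeasure_sampleMean (integrable_stopLoss hX) (fun i => (hid i).comp hmeas)
    fun i j hij => (hind hij).comp hmeas hmeas

theorem tendsto_measure_upperInt_centeredCdf_inner [FiniteDimensional ℝ E] {ε η : ℝ}
    (hX : Integrable X P) (hid : ∀ i, IdentDistrib (Xs i) X P' P)
    (hind : Pairwise fun i j => IndepFun (Xs i) (Xs j) P') (hε : 0 < ε) (hη : 0 < η) :
    Tendsto (fun n => P' {ω | ¬ ∀ q ∈ Metric.sphere (0 : E) 1, ∀ α ∈ Icc ε (1 - ε),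
      |upperInt (centeredCdf (sampleMeasure n) fun i => inner ℝ (Xs i ω) q) α -
        upperInt (centeredCdf P fun ω => inner ℝ (X ω) q) α| ≤ η}) atTop (𝓝 0) := by
  obtain ⟨M, hM⟩ : ∃ M, ε * M = ∫ ω, ‖X ω‖ ∂P + 2 * (η / 3) := ⟨_, mul_div_cancel₀ _ hε.ne'⟩
  have hM0 : 0 ≤ M := nonneg_of_mul_nonneg_right
    (hM.symm ▸ add_nonneg (integral_nonneg fun _ => norm_nonneg _) (by positivity)) hε
  let K : Set (E × ℝ) := Metric.sphere (0 : E) 1 ×ˢ Icc (-M) M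
  have : CompactSpace K :=
    isCompact_iff_compactSpace.1 ((isCompact_sphere 0 1).prod isCompact_Icc)
  have hlln := tendstoInMeasure_iff_norm.1
    (tendstoInMeasure_sampleMean_stopLoss (K := K) hX hid hind) (η / 3) (by positivity)
  refine tendsto_of_tendsto_of_tendsto_of_le_of_le' tendsto_const_nhds hlln
    (.of_forall fun _ => zero_le) ?_
  filter_upwards [eventually_ne_atTop 0] with n hn
  refine measure_mono (ofPred_subset_ofPred.2 fun ω hω => ?_)
  by_contra! hclose
  refine hω fun q hq α hα => ?_
  have := isProbabilityMeasure_sampleMeasure hn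
  rw [← integral_sampleMeasure] at hclose
  have h := abs_upperInt_centeredCdf_inner_sub_le hX (integrable_sampleMeasure hn _) hε hα hM.ge
    hclose.le (mem_sphere_zero_iff_norm.1 hq).le ⟨by simpa using hq, by simpa using hM0⟩
    fun c hc => ⟨hq, abs_le.1 hc⟩
  exact h.trans_eq (mul_div_cancel₀ η three_ne_zero)

theorem tendsto_measure_upperInt_centeredCdf {W : Ω → ℝ} {Ws : ℕ → Ω' → ℝ} {ε η : ℝ}
    (hW : Integrable W P) (hid : ∀ i, IdentDistrib (Ws i) W P' P)
    (hind : Pairwise fun i j => IndepFun (Ws i) (Ws j) P') (hε : 0 < ε) (hη : 0 < η) :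
    Tendsto (fun n => P' {ω | ¬ ∀ α ∈ Icc ε (1 - ε),
      |upperInt (centeredCdf (sampleMeasure n) fun i => Ws i ω) α -
        upperInt (centeredCdf P W) α| ≤ η}) atTop (𝓝 0) := by
  have h := tendsto_measure_upperInt_centeredCdf_inner hW hid hind hε hη
  refine tendsto_of_tendsto_of_tendsto_of_le_of_le tendsto_const_nhds h (fun _ => zero_le) ?_
  refine fun n => measure_mono (ofPred_subset_ofPred.2 fun ω hω hclose => hω ?_)
  simpa using hclose 1 (by simp)

end StopLoss

section NonDegenerate

variable {Ω : Type*} [MeasurableSpace Ω] {P : Measure Ω} [IsProbabilityMeasure P]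

theorem integral_abs_sub_integral_pos {W : Ω → ℝ} (hW : Integrable W P)
    (hconst : ∀ c, ¬ ∀ᵐ ω ∂P, W ω = c) : 0 < ∫ ω, |W ω - ∫ ω', W ω' ∂P| ∂P := by
  refine (integral_nonneg fun _ => abs_nonneg _).lt_of_ne' fun h => hconst (∫ ω, W ω ∂P) ?_
  have habs : Integrable (fun ω => |W ω - ∫ ω', W ω' ∂P|) P := (hW.sub (integrable_const _)).abs
  filter_upwards [(integral_eq_zero_iff_of_nonneg (fun _ => abs_nonneg _) habs).1 h] with ω hω
  exact sub_eq_zero.1 (abs_eq_zero.1 hω)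

omit [IsProbabilityMeasure P] in
theorem continuous_integral_abs_inner {E : Type*} [NormedAddCommGroup E] [InnerProductSpace ℝ E]
    {X : Ω → E} (hX : Integrable X P) : Continuous fun q : E => ∫ ω, |inner ℝ (X ω) q| ∂P := by
  refine continuous_iff_continuousAt.2 fun q₀ => continuousAt_of_dominated
    (bound := fun ω => ‖X ω‖ * (‖q₀‖ + 1))
    (.of_forall fun q => (hX.inner_const q).abs.aestronglyMeasurable) ?_ (hX.norm.mul_const _)
    (.of_forall fun ω => by fun_prop)
  filter_upwards [continuous_norm.continuousAt.eventually_le_const (lt_add_one ‖q₀‖)] with q hq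
  refine .of_forall fun ω => ?_
  rw [Real.norm_eq_abs, abs_abs]
  exact (abs_real_inner_le_norm _ _).trans (by gcongr)

theorem continuous_integral_abs_inner_sub_integral {E : Type*} [NormedAddCommGroup E]
    [InnerProductSpace ℝ E] [CompleteSpace E] {X : Ω → E} (hX : Integrable X P) :
    Continuous fun q : E => ∫ ω, |inner ℝ (X ω) q - ∫ ω', inner ℝ (X ω') q ∂P| ∂P := by
  simpa only [Pi.sub_apply, inner_sub_left, ← integral_inner_const hX] using
    continuous_integral_abs_inner (hX.sub (integrable_const (∫ ω, X ω ∂P)))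

theorem exists_pos_forall_le_upperInt_centeredCdf_inner {E : Type*} [NormedAddCommGroup E]
    [InnerProductSpace ℝ E] [FiniteDimensional ℝ E] {X : Ω → E} (hX : Integrable X P)
    (hconst : ∀ q ≠ 0, ∀ c : ℝ, ¬ ∀ᵐ ω ∂P, inner ℝ (X ω) q = c) {ε : ℝ} (hε : 0 < ε) :
    ∃ d > 0, ∀ q ∈ Metric.sphere (0 : E) 1, ∀ α ∈ Icc ε (1 - ε),
      d ≤ upperInt (centeredCdf P fun ω => inner ℝ (X ω) q) α := by
  have hpos : ∀ q ∈ Metric.sphere (0 : E) 1,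
      0 < ε / 2 * ∫ ω, |inner ℝ (X ω) q - ∫ ω', inner ℝ (X ω') q ∂P| ∂P := fun q hq =>
    mul_pos (half_pos hε) (integral_abs_sub_integral_pos (hX.inner_const q)
      (hconst q (ne_zero_of_mem_unit_sphere ⟨q, hq⟩)))
  obtain ⟨d, hd, hle⟩ := (isCompact_sphere (0 : E) 1).exists_forall_le'
    ((continuous_integral_abs_inner_sub_integral hX).const_mul (ε / 2)).continuousOn hpos
  refine ⟨d, hd, fun q hq α hα => (hle q hq).trans ?_⟩
  linarith [mul_integral_abs_le_two_mul_upperInt_centeredCdf (hX.inner_const q) hε hα]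

variable {p : ℕ} {X : Ω → EuclideanSpace ℝ (Fin p)}

theorem varianceMatrix_mulVec_apply (hX : MemLp X 2 P) (q : EuclideanSpace ℝ (Fin p)) (i : Fin p) :
    (varianceMatrix P X).mulVec q.ofLp i =
      covariance (fun ω => X ω i) (fun ω => inner ℝ (X ω) q) P := by
  have hcoord : ∀ j, MemLp (fun ω => X ω j) 2 P := fun j =>
    (EuclideanSpace.proj (𝕜 := ℝ) j).comp_memLp' hX
  have hinner : (fun ω => inner ℝ (X ω) q) = fun ω => ∑ j, X ω j * q j := by
    ext ω
    simp [PiLp.inner_apply, mul_comm]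
  rw [hinner, covariance_fun_sum_right (fun j => (hcoord j).mul_const _) (hcoord i)]
  simp only [covariance_mul_const_right, Matrix.mulVec, dotProduct, varianceMatrix, Matrix.of_apply]

theorem not_ae_inner_eq_const_of_det_varianceMatrix_ne_zero (hX : MemLp X 2 P)
    (hV : (varianceMatrix P X).det ≠ 0) {q : EuclideanSpace ℝ (Fin p)} (hq : q ≠ 0) (c : ℝ) :
    ¬ ∀ᵐ ω ∂P, inner ℝ (X ω) q = c := fun h => by
  refine hq (WithLp.ofLp_injective 2 (Matrix.eq_zero_of_mulVec_eq_zero hV (funext fun i => ?_)))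
  have hmean : ∫ ω, inner ℝ (X ω) q ∂P = c := by
    rw [integral_congr_ae h, integral_const, probReal_univ, one_smul]
  rw [varianceMatrix_mulVec_apply hX, covariance, hmean]
  refine integral_eq_zero_of_ae ?_
  filter_upwards [h] with ω hω
  rw [hω, sub_self, mul_zero, Pi.zero_apply]

end NonDegenerate

section StarSet

theorem exists_pos_forall_abs_div_sub_div_le {C d ρ : ℝ} (hd : 0 < d) (hρ : 0 < ρ) :
    ∃ η > 0, ∀ {N N' D D' : ℝ}, 0 ≤ N → N ≤ C → d ≤ D → |N' - N| ≤ η → |D' - D| ≤ η →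
      0 < D' ∧ |N' / D' - N / D| ≤ ρ := by
  have hlim : Tendsto (fun η : ℝ => η / (d / 2) + C * η / (d / 2 * d)) (𝓝[>] 0) (𝓝 0) :=
    tendsto_nhdsWithin_of_tendsto_nhds (Continuous.tendsto' (by fun_prop) _ _ (by simp))
  obtain ⟨η, ⟨hη, hηd⟩, hηρ⟩ :=
    ((eventually_mem_set.2 (Ioo_mem_nhdsGT (half_pos hd))).and (hlim.eventually_le_const hρ)).exists
  refine ⟨η, hη, fun {N N' D D'} hN hNC hD hN' hD' => ?_⟩
  have hDpos : 0 < D := hd.trans_le hD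
  have hD'd : d / 2 ≤ D' := by linarith [(abs_le.1 hD').1]
  have hD'pos : 0 < D' := (half_pos hd).trans_le hD'd
  refine ⟨hD'pos, ?_⟩
  calc |N' / D' - N / D| = |(N' - N) / D' - N * (D' - D) / (D' * D)| := by
        congr 1
        field_simp
        ring
    _ ≤ |(N' - N) / D'| + |N * (D' - D) / (D' * D)| := abs_sub _ _
    _ = |N' - N| / D' + N * |D' - D| / (D' * D) := by
        rw [abs_div, abs_div, abs_mul, abs_of_nonneg hN, abs_of_pos hD'pos,
          abs_of_pos (mul_pos hD'pos hDpos)]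
    _ ≤ η / (d / 2) + C * η / (d / 2 * d) := by
        have hC : 0 ≤ C := hN.trans hNC
        gcongr
    _ ≤ ρ := hηρ

variable {ε : ℝ}

theorem coe_le_radial_iff {F G : ℝ → ℝ} (hG : ∀ α ∈ Icc ε (1 - ε), upperInt G α ≠ 0) {l : ℝ} :
    (l : EReal) ≤ radial ε F G ↔ ∀ α ∈ Icc ε (1 - ε), l ≤ upperInt F α / upperInt G α := by
  rw [radial, le_iInf₂_iff]
  refine forall₂_congr fun α hα => ?_
  rw [superquantileRatio, if_neg (hG α hα), EReal.coe_le_coe_iff]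

variable {p : ℕ} {F F' : ℝ → ℝ} {G G' : EuclideanSpace ℝ (Fin p) → ℝ → ℝ} {ρ : ℝ}

theorem exists_mem_starSet_edist_le (hρ : 0 ≤ ρ)
    (hG : ∀ q ∈ Metric.sphere 0 1, ∀ α ∈ Icc ε (1 - ε), 0 < upperInt (G q) α)
    (hF' : ∀ α ∈ Icc ε (1 - ε), 0 ≤ upperInt F' α)
    (hG' : ∀ q ∈ Metric.sphere 0 1, ∀ α ∈ Icc ε (1 - ε), 0 < upperInt (G' q) α)
    (h : ∀ q ∈ Metric.sphere 0 1, ∀ α ∈ Icc ε (1 - ε),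
      upperInt F α / upperInt (G q) α ≤ upperInt F' α / upperInt (G' q) α + ρ) :
    ∀ b ∈ starSet ε F G, ∃ b' ∈ starSet ε F' G', edist b b' ≤ ENNReal.ofReal ρ := by
  rintro _ ⟨q, hq, l, hl0, hl, rfl⟩
  rw [coe_le_radial_iff fun α hα => (hG q hq α hα).ne'] at hl
  refine ⟨max (l - ρ) 0 • q, ⟨q, hq, max (l - ρ) 0, le_max_right _ _, ?_, rfl⟩, ?_⟩
  · refine (coe_le_radial_iff fun α hα => (hG' q hq α hα).ne').2 fun α hα => max_le ?_ ?_
    · linarith [hl α hα, h q hq α hα]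
    · exact div_nonneg (hF' α hα) (hG' q hq α hα).le
  · rw [edist_dist, dist_eq_norm, ← sub_smul, norm_smul, mem_sphere_zero_iff_norm.1 hq, mul_one]
    refine ENNReal.ofReal_le_ofReal (abs_le.2 ⟨?_, ?_⟩)
    · linarith [max_le (sub_le_self l hρ) hl0]
    · linarith [le_max_left (l - ρ) 0]

theorem exists_pos_forall_hausdorffEDist_starSet_le {C d : ℝ} (hd : 0 < d) (hρ : 0 < ρ)
    (hF : ∀ α ∈ Icc ε (1 - ε), upperInt F α ∈ Icc 0 C)
    (hG : ∀ q ∈ Metric.sphere 0 1, ∀ α ∈ Icc ε (1 - ε), d ≤ upperInt (G q) α) :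
    ∃ η > 0, ∀ {F' : ℝ → ℝ} {G' : EuclideanSpace ℝ (Fin p) → ℝ → ℝ},
      (∀ α ∈ Icc ε (1 - ε), 0 ≤ upperInt F' α) →
      (∀ α ∈ Icc ε (1 - ε), |upperInt F' α - upperInt F α| ≤ η) →
      (∀ q ∈ Metric.sphere 0 1, ∀ α ∈ Icc ε (1 - ε),
        |upperInt (G' q) α - upperInt (G q) α| ≤ η) →
      Metric.hausdorffEDist (starSet ε F' G') (starSet ε F G) ≤ ENNReal.ofReal ρ := by
  obtain ⟨η, hη, hquot⟩ := exists_pos_forall_abs_div_sub_div_le (C := C) hd hρ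
  refine ⟨η, hη, fun {F' G'} hF' hFF' hGG' => ?_⟩
  have hGpos : ∀ q ∈ Metric.sphere 0 1, ∀ α ∈ Icc ε (1 - ε), 0 < upperInt (G q) α :=
    fun q hq α hα => hd.trans_le (hG q hq α hα)
  have hclose : ∀ q ∈ Metric.sphere 0 1, ∀ α ∈ Icc ε (1 - ε), 0 < upperInt (G' q) α ∧
      |upperInt F' α / upperInt (G' q) α - upperInt F α / upperInt (G q) α| ≤ ρ :=
    fun q hq α hα => hquot (hF α hα).1 (hF α hα).2 (hG q hq α hα) (hFF' α hα) (hGG' q hq α hα)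
  have hGpos' : ∀ q ∈ Metric.sphere 0 1, ∀ α ∈ Icc ε (1 - ε), 0 < upperInt (G' q) α :=
    fun q hq α hα => (hclose q hq α hα).1
  exact Metric.hausdorffEDist_le_of_mem_edist
    (exists_mem_starSet_edist_le hρ.le hGpos' (fun α hα => (hF α hα).1) hGpos fun q hq α hα => by
      linarith [(abs_le.1 (hclose q hq α hα).2).2])
    (exists_mem_starSet_edist_le hρ.le hGpos hF' hGpos' fun q hq α hα => by
      linarith [(abs_le.1 (hclose q hq α hα).2).1])

end StarSet

theorem comap_effectiveSize_atTop_le : comap effectiveSize atTop ≤ atTop ×ˢ atTop := by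
  refine le_inf (tendsto_iff_comap.1 ?_) (tendsto_iff_comap.1 ?_) <;>
    rw [← tendsto_natCast_atTop_iff (R := ℝ)] <;>
    refine tendsto_atTop_mono (fun m => ?_) tendsto_comap <;>
    exact div_le_of_le_mul₀ (by positivity) (by positivity)
      (by nlinarith [mul_self_nonneg (m.1 : ℝ), mul_self_nonneg (m.2 : ℝ)])

theorem exists_pos_forall_hausdorffEDist_pluginSet_lt {p : ℕ} {Ω : Type*} [MeasurableSpace Ω]
    {P : Measure Ω} [IsProbabilityMeasure P] {Y : Ω → ℝ} {X : Ω → EuclideanSpace ℝ (Fin p)}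
    (hY : Integrable Y P) (hX : Integrable X P)
    (hconst : ∀ q ≠ 0, ∀ c : ℝ, ¬ ∀ᵐ ω ∂P, inner ℝ (X ω) q = c) {ε δ : ℝ} (hε : 0 < ε)
    (hδ : 0 < δ) :
    ∃ η > 0, ∀ {nY nX : ℕ} {y : ℕ → ℝ} {x : ℕ → EuclideanSpace ℝ (Fin p)}, nY ≠ 0 → nX ≠ 0 →
      (∀ α ∈ Icc ε (1 - ε), |upperInt (centeredCdf (sampleMeasure nY) y) α -
        upperInt (centeredCdf P Y) α| ≤ η) →
      (∀ q ∈ Metric.sphere 0 1, ∀ α ∈ Icc ε (1 - ε),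
        |upperInt (centeredCdf (sampleMeasure nX) fun i => inner ℝ (x i) q) α -
          upperInt (centeredCdf P fun ω => inner ℝ (X ω) q) α| ≤ η) →
      Metric.hausdorffEDist (pluginSet ε nY nX y x) (regularizedSet P ε Y X) <
        ENNReal.ofReal δ := by
  obtain ⟨d, hd, hdX⟩ := exists_pos_forall_le_upperInt_centeredCdf_inner hX hconst hε
  obtain ⟨η, hη, hstable⟩ := exists_pos_forall_hausdorffEDist_starSet_le hd (half_pos hδ)
    (fun α hα => ⟨upperInt_centeredCdf_nonneg hY hε hα,
      upperInt_centeredCdf_le hY (Icc_subset_Ioo hε (sub_lt_self 1 hε) hα)⟩) hdX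
  refine ⟨η, hη, fun {nY nX y x} hnY hnX hYclose hXclose => ?_⟩
  rw [pluginSet_eq_starSet hnY hnX, regularizedSet_eq_starSet ε Y hX]
  have := isProbabilityMeasure_sampleMeasure hnY
  have hY0 : ∀ α ∈ Icc ε (1 - ε), 0 ≤ upperInt (centeredCdf (sampleMeasure nY) y) α :=
    fun α hα => upperInt_centeredCdf_nonneg (integrable_sampleMeasure hnY y) hε hα
  exact (hstable hY0 hYclose hXclose).trans_lt
    ((ENNReal.ofReal_lt_ofReal_iff hδ).2 (half_lt_self hδ))

end TwoSample

theorem theorem2_general {p : ℕ}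
    {Ω₀ : Type*} [MeasurableSpace Ω₀] {P₀ : Measure Ω₀} [IsProbabilityMeasure P₀]
    {Y : Ω₀ → ℝ} {X : Ω₀ → EuclideanSpace ℝ (Fin p)}
    (hY : Integrable Y P₀) (hX : Integrable X P₀)
    (hconst : ∀ q ≠ 0, ∀ c : ℝ, ¬ ∀ᵐ ω ∂P₀, inner ℝ (X ω) q = c)
    {Ω : Type*} [MeasurableSpace Ω] {P : Measure Ω} [IsProbabilityMeasure P]
    {Ys : ℕ → Ω → ℝ} {Xs : ℕ → Ω → EuclideanSpace ℝ (Fin p)}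
    (hYid : ∀ i, IdentDistrib (Ys i) Y P P₀) (hXid : ∀ i, IdentDistrib (Xs i) X P P₀)
    (hYind : Pairwise fun i j => IndepFun (Ys i) (Ys j) P)
    (hXind : Pairwise fun i j => IndepFun (Xs i) (Xs j) P)
    {ε : ℝ} (hε : 0 < ε) {δ : ℝ} (hδ : 0 < δ) :
    Tendsto
      (fun m : ℕ × ℕ => P {ω | ENNReal.ofReal δ ≤
        Metric.hausdorffEDist
          (TwoSample.pluginSet ε m.1 m.2 (fun i => Ys i ω) (fun i => Xs i ω))
          (TwoSample.regularizedSet P₀ ε Y X)})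
      (atTop ×ˢ atTop) (𝓝 0) := by
  obtain ⟨η, hη, hclose⟩ :=
    TwoSample.exists_pos_forall_hausdorffEDist_pluginSet_lt hY hX hconst hε hδ
  have hYlln := TwoSample.tendsto_measure_upperInt_centeredCdf hY hYid hYind hε hη
  have hXlln := TwoSample.tendsto_measure_upperInt_centeredCdf_inner hX hXid hXind hε hη
  refine tendsto_of_tendsto_of_tendsto_of_le_of_le' tendsto_const_nhds
    (add_zero (0 : ENNReal) ▸ (hYlln.comp tendsto_fst).add (hXlln.comp tendsto_snd))
    (.of_forall fun _ => zero_le) ?_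
  filter_upwards [(eventually_ne_atTop 0).prod_mk (eventually_ne_atTop 0)] with m ⟨hnY, hnX⟩
  refine (measure_mono fun ω hω => ?_).trans (measure_union_le _ _)
  by_contra hgood
  obtain ⟨hYgood, hXgood⟩ := not_or.1 hgood
  exact (hclose hnY hnX (not_not.1 hYgood) (not_not.1 hXgood)).not_ge hω

theorem theorem2 {p : ℕ}
    -- the population, on which `Y` and `X` have the moment and linearity properties
    {Ω₀ : Type*} [MeasurableSpace Ω₀] (P₀ : Measure Ω₀) [IsProbabilityMeasure P₀]
    (Y : Ω₀ → ℝ) (X : Ω₀ → EuclideanSpace ℝ (Fin p))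
    (hYmeas : Measurable Y) (hXmeas : Measurable X)
    (hY2 : MemLp Y 2 P₀) (hX2 : MemLp X 2 P₀)
    (hVY : 0 < variance Y P₀) (hVX : (TwoSample.varianceMatrix P₀ X).det ≠ 0)
    (hlin : ∃ (α₀ : ℝ) (β₀ : EuclideanSpace ℝ (Fin p)),
      P₀[Y | MeasurableSpace.comap X inferInstance] =ᵐ[P₀] fun ω => α₀ + inner ℝ (X ω) β₀)
    -- the two independent i.i.d. samples
    {Ω : Type*} [MeasurableSpace Ω] (P : Measure Ω) [IsProbabilityMeasure P]
    (Ys : ℕ → Ω → ℝ) (Xs : ℕ → Ω → EuclideanSpace ℝ (Fin p))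
    (hYid : ∀ i, IdentDistrib (Ys i) Y P P₀) (hXid : ∀ i, IdentDistrib (Xs i) X P P₀)
    (hYind : iIndepFun Ys P) (hXind : iIndepFun Xs P)
    (hYX : IndepFun (fun ω i => Ys i ω) (fun ω i => Xs i ω) P)
    -- the regularization parameter
    (ε : ℝ) (hε0 : 0 < ε) (hε1 : ε < 1 / 2) :
    ∀ δ : ℝ, 0 < δ →
      Tendsto
        (fun m : ℕ × ℕ => P {ω | ENNReal.ofReal δ ≤
          Metric.hausdorffEDist
            (TwoSample.pluginSet ε m.1 m.2 (fun i => Ys i ω) (fun i => Xs i ω))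
            (TwoSample.regularizedSet P₀ ε Y X)})
        (comap TwoSample.effectiveSize atTop) (𝓝 0) := fun _ hδ =>
  (theorem2_general (hY2.integrable one_le_two) (hX2.integrable one_le_two)
    (fun _ => TwoSample.not_ae_inner_eq_const_of_det_varianceMatrix_ne_zero hX2 hVX) hYid hXid
    (fun _ _ => hYind.indepFun) (fun _ _ => hXind.indepFun) hε0 hδ).mono_left
    TwoSample.comap_effectiveSize_atTop_le
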